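/- A graph of type $3_n$ is (the skeleton of) a simple polyhedron with $n$ vertices and only triangular and hexagonal faces, i.e. a finite simple $3$-connected $3$-valent plane graph with $n$ vertices, each of whose faces (the outer one included) is a triangle or a hexagon, with at least one triangle (there may be no hexagon). A railroad in such a graph is a circuit of hexagonal faces in which every hexagon is adjacent to its predecessor and to its successor on opposite edges (the circuit may cross itself); the graph is tight if it has no railroad. Theorem. Let $n>4$ be an integer divisible by $4$. Then all graphs of type $3_n$ are tight if and only if $\frac n4$ is prime. -/

import Mathlib

/-- A combinatorial map on a type `D` of darts (edges with a chosen direction): the standard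
combinatorial description of a graph drawn on an oriented closed surface.
`opp` reverses a dart; `rot` sends a dart `d` to the next dart, in clockwise order, among the darts
with the same tail as `d`. -/
structure CombinatorialMap (D : Type*) where
  rot : Equiv.Perm D
  opp : Equiv.Perm D
  opp_opp : ∀ d, opp (opp d) = d
  opp_ne : ∀ d, opp d ≠ d

namespace CombinatorialMap

variable {D : Type*} (M : CombinatorialMap D)

/-- The next dart on the boundary of the face lying to the left of a dart: on arriving at the head
of the dart, turn to the edge next to it in clockwise order. -/
def next : Equiv.Perm D := M.opp.trans M.rot

/-- The vertices are the cycles of `rot`. -/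
def Vertex : Type _ := Quotient (Equiv.Perm.SameCycle.setoid M.rot)

/-- The edges are the pairs `{d, opp d}`. -/
def Edge : Type _ := Quotient (Equiv.Perm.SameCycle.setoid M.opp)

/-- The faces are the cycles of `next`. -/
def Face : Type _ := Quotient (Equiv.Perm.SameCycle.setoid M.next)

/-- The tail of a dart. The head of `d` is `M.tail (M.opp d)`. -/
def tail (d : D) : M.Vertex := Quotient.mk _ d

/-- The face to the left of a dart. -/
def leftFace (d : D) : M.Face := Quotient.mk _ d

/-- The number of darts leaving a vertex. -/
noncomputable def degree (v : M.Vertex) : ℕ := Nat.card {d : D // M.tail d = v}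

/-- The number of sides of a face. -/
noncomputable def faceSize (f : M.Face) : ℕ := Nat.card {d : D // M.leftFace d = f}

/-- The underlying graph. -/
def skeleton : SimpleGraph M.Vertex where
  Adj u v := u ≠ v ∧ ∃ d, M.tail d = u ∧ M.tail (M.opp d) = v
  symm := ⟨fun u v h => by
    obtain ⟨hne, d, hu, hv⟩ := h
    exact ⟨hne.symm, M.opp d, hv, by rw [M.opp_opp]; exact hu⟩⟩
  loopless := ⟨fun _ h => h.1 rfl⟩

/-- The drawn graph has neither loops nor multiple edges. -/
def IsSimple : Prop :=
  (∀ d, M.tail (M.opp d) ≠ M.tail d) ∧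
    ∀ d e, M.tail d = M.tail e → M.tail (M.opp d) = M.tail (M.opp e) → d = e

/-- A plane graph: connected, and drawn on the sphere (Euler characteristic `2`). -/
def IsPlane : Prop :=
  M.skeleton.Connected ∧ Nat.card M.Vertex + Nat.card M.Face = Nat.card M.Edge + 2

/-- A graph is `3`-connected if it has more than three vertices and stays connected after the
deletion of any set of fewer than three vertices. -/
def IsThreeConnected {V : Type*} (G : SimpleGraph V) : Prop :=
  3 < ENat.card V ∧ ∀ S : Set V, S.encard < 3 → (G.induce Sᶜ).Connected

/-- Polyhedra, identified with their skeletons: simple `3`-connected plane graphs. -/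
def IsPolyhedral : Prop := M.IsSimple ∧ M.IsPlane ∧ IsThreeConnected M.skeleton

/-- The graphs of type `3_n`: `3`-valent polyhedra with `n` vertices, all of whose faces are
triangles or hexagons, with at least one triangle and possibly no hexagon. -/
structure IsTypeThree (n : ℕ) : Prop where
  polyhedral : M.IsPolyhedral
  card_vertex : Nat.card M.Vertex = n
  degree_eq : ∀ v, M.degree v = 3
  faceSize_eq : ∀ f, M.faceSize f = 3 ∨ M.faceSize f = 6
  exists_triangle : ∃ f, M.faceSize f = 3

/-- A railroad: a circuit of hexagons `H i`, indexed cyclically, each adjacent to its two neighbours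
on opposite edges. It is recorded by the darts `entry i`, where `entry i` is the side of `H i`
(with `H i` to its left) shared with `H (i - 1)`; the opposite side of `H i`, three steps further
along its boundary, is the side shared with `H (i + 1)`. A hexagon may be traversed several times
(in different directions), but the circuit is not repeated. -/
structure Railroad where
  length : ℕ
  length_pos : 0 < length
  entry : ZMod length → D
  entry_injective : Function.Injective entry
  hexagonal : ∀ i, M.faceSize (M.leftFace (entry i)) = 6
  step : ∀ i, entry (i + 1) = M.opp (M.next (M.next (M.next (entry i))))

/-- A plane graph is tight if it has no railroad. -/
def IsTight : Prop := IsEmpty M.Railroad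

end CombinatorialMap

/-! A graph of type 3_n is a quotient of the hexagonal tiling in which a triangle is a hexagon
folded by the half turn about its centre: `next ^ 6 = 1` and `rot ^ 3 = 1` on darts. So the
translations of the tiling act on darts, and one step of a railroad is the translation by `(1, 0)`.
Fix a dart d of a triangle and let N be the lattice of translations fixing d. Every dart is a
translate of d up to one or two applications of `next`, which gives N index n
(`IsTypeThree.index_period`). Since `opp` fixes no dart, N lies in 2ℤ² (`even_of_mem_period`). Hence
N = 2L with L of index n/4, and the translate of d by w lies on a triangle exactly when w ∈ L.

Let n/4 be prime. For a suitable side d of a triangle, a railroad is a coset of the line ℤ(1, 0)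
that misses L, so L + ℤ(1, 0) is not everything and primality puts (1, 0) in L
(`mem_of_index_prime`). Then two triangles share an edge, which 3-connectedness allows only on at
most four vertices (`card_vertex_le_four`).

Let n/4 = ab with a, b ≥ 2. The choice L = aℤ × bℤ is realised by `sumMap`: its vertices form ℤ/2a ×
ℤ/2b, and the half turn about an edge midpoint becomes z ↦ c - z. Some line of hexagons in the first
direction misses all triangles and is a railroad. The main work is 3-connectedness: rings in two
directions cross so often that deleting two vertices cannot separate them (`sumGraph.exists_hub`).
-/

open Equiv

/-! ### Cycles of a permutation as fibres of a quotient -/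

/-- The fibre of the quotient by a permutation over the class of `d` has as many elements as the
period of `d`. -/
theorem card_sameCycle_fiber {D : Type*} [Finite D] (p : Perm D) (d : D) :
    Nat.card {e : D // (Quotient.mk (Perm.SameCycle.setoid p) e) = Quotient.mk _ d} =
      Function.minimalPeriod p d := by
  classical
  have := Fintype.ofFinite D
  have h := MulAction.minimalPeriod_eq_card (a := p) (b := d)
  have h' : Function.minimalPeriod p d = Function.minimalPeriod (p • ·) d := rfl
  rw [h', h, ← Nat.card_eq_fintype_card]
  refine Nat.card_congr (Equiv.subtypeEquivRight fun e => ?_)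
  rw [Quotient.eq]
  change p.SameCycle e d ↔ _
  rw [Perm.sameCycle_comm, MulAction.mem_orbit_iff]
  constructor
  · rintro ⟨i, hi⟩
    exact ⟨⟨p ^ i, i, rfl⟩, hi⟩
  · rintro ⟨⟨_, i, rfl⟩, hi⟩
    exact ⟨i, hi⟩

/-- Counting a type by the fibres of a quotient all of which have the same size. -/
theorem card_quotient_mul {D : Type*} [Finite D] (s : Setoid D) (k : ℕ)
    (h : ∀ q : Quotient s, Nat.card {e : D // Quotient.mk s e = q} = k) :
    Nat.card (Quotient s) * k = Nat.card D := by
  classical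
  have := Fintype.ofFinite D
  have := Fintype.ofFinite (Quotient s)
  rw [Nat.card_congr (Equiv.sigmaFiberEquiv (Quotient.mk s)).symm, Nat.card_sigma,
    Finset.sum_congr rfl (fun q _ => h q)]
  simp

/-! ### Relations between words in `opp` (a) and `next` (f) -/

namespace CombinatorialMap

section group_words

variable {G : Type*} [Group G] {a f : G}

/-- This is the vertex relation `(f * a) ^ 3 = 1` solved for a subword, so that it can be used to
trade two letters `a` for one. -/
theorem opp_mul_next_mul_opp (ha : a * a = 1) (hr : (f * a) ^ 3 = 1) :
    a * f * a = f⁻¹ * a * f⁻¹ := by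
  have h : f * a * f * a * f * a = 1 := by simpa [pow_succ, mul_assoc] using hr
  have ha' : a⁻¹ = a := inv_eq_of_mul_eq_one_left ha
  have h2 : f * a * f * a * f * a * a⁻¹ * f⁻¹ = a⁻¹ * f⁻¹ := by rw [h, one_mul]
  have h3 : f * (a * f * a) = a * f⁻¹ := by
    rw [ha'] at h2
    calc f * (a * f * a) = f * a * f * a * f * (a * a) * f⁻¹ := by rw [ha]; group
      _ = a * f⁻¹ := by rw [← h2]; group
  rw [eq_comm, mul_assoc, ← h3]; group

theorem opp_mul_next_inv_mul_opp (ha : a * a = 1) (hr : (f * a) ^ 3 = 1) :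
    a * f⁻¹ * a = f * a * f := by
  have ha' : a⁻¹ = a := inv_eq_of_mul_eq_one_left ha
  have := congrArg (·⁻¹) (opp_mul_next_mul_opp ha hr)
  simpa [mul_assoc, ha'] using this

/-- Two translations whose product is the conjugate of the first by the rotation `f`. -/
theorem translation_mul (ha : a * a = 1) (hf : f ^ 6 = 1) (hr : (f * a) ^ 3 = 1) :
    (a * f ^ 3) * (f ^ 2 * a * f) = f * (a * f ^ 3) * f⁻¹ := by
  have h5 : f ^ 3 * f ^ 2 = f⁻¹ := by rw [eq_inv_iff_mul_eq_one]; rw [← hf]; group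
  calc (a * f ^ 3) * (f ^ 2 * a * f) = a * (f ^ 3 * f ^ 2) * a * f := by group
    _ = (f * a * f) * f := by rw [h5, opp_mul_next_inv_mul_opp ha hr]
    _ = _ := by simp only [pow_succ, pow_zero, one_mul]; group

/-- The right-hand side is that of `translation_mul`, so the two translations commute. -/
theorem translation_mul' (ha : a * a = 1) (hr : (f * a) ^ 3 = 1) :
    (f ^ 2 * a * f) * (a * f ^ 3) = f * (a * f ^ 3) * f⁻¹ := by
  calc (f ^ 2 * a * f) * (a * f ^ 3) = f ^ 2 * (a * f * a) * f ^ 3 := by group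
    _ = _ := by rw [opp_mul_next_mul_opp ha hr]; group

/-- With ω the sixth root of unity, the two translations are those by 1 and ω², and this is ω · ω² =
-1; likewise `translation_mul` is 1 + ω² = ω. -/
theorem conj_translation (ha : a * a = 1) (hf : f ^ 6 = 1) :
    f * (f ^ 2 * a * f) * f⁻¹ = (a * f ^ 3)⁻¹ := by
  have ha' : a⁻¹ = a := inv_eq_of_mul_eq_one_left ha
  have h3 : (f ^ 3)⁻¹ = f ^ 3 := by rw [inv_eq_iff_mul_eq_one, ← hf]; group
  rw [mul_inv_rev, ha', h3]; group

end group_words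

end CombinatorialMap

/-! ### The lattice of translations acting on darts -/

namespace CombinatorialMap

variable {D : Type*} (M : CombinatorialMap D)

/-- Every face closes up after six steps and every vertex after three: the map is a quotient of
the hexagonal tiling of the plane. -/
structure IsHexagonalQuotient : Prop where
  next_pow : M.next ^ 6 = 1
  rot_pow : M.rot ^ 3 = 1

/-- The translations of the hexagonal tiling, acting on darts. -/
def translation (z : ℤ × ℤ) : Perm D :=
  (M.opp * M.next ^ 3) ^ z.1 * (M.next ^ 2 * M.opp * M.next) ^ z.2

/-- The multiplication by a primitive sixth root of unity on the Eisenstein integers. -/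
def turn (z : ℤ × ℤ) : ℤ × ℤ := (z.1 - z.2, z.1)

variable {M}

theorem opp_mul_opp : M.opp * M.opp = 1 := Equiv.ext M.opp_opp

theorem next_eq : M.next = M.rot * M.opp := rfl

theorem next_mul_opp : M.next * M.opp = M.rot := by
  rw [next_eq, mul_assoc, opp_mul_opp, mul_one]

theorem translation_zero : M.translation 0 = 1 := by simp [translation]

theorem translation_one : M.translation (1, 0) = M.opp * M.next ^ 3 := by simp [translation]

namespace IsHexagonalQuotient

theorem rot_pow' (h : M.IsHexagonalQuotient) : (M.next * M.opp) ^ 3 = 1 := by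
  rw [next_mul_opp, h.rot_pow]

theorem commute (h : M.IsHexagonalQuotient) :
    Commute (M.opp * M.next ^ 3) (M.next ^ 2 * M.opp * M.next) :=
  (translation_mul opp_mul_opp h.next_pow h.rot_pow').trans
    (translation_mul' opp_mul_opp h.rot_pow').symm

theorem translation_add (h : M.IsHexagonalQuotient) (z w : ℤ × ℤ) :
    M.translation (z + w) = M.translation z * M.translation w := by
  simp only [translation, Prod.fst_add, Prod.snd_add, zpow_add]
  exact (h.commute.zpow_zpow w.1 z.2).mul_mul_mul_comm _ _

theorem translation_neg (h : M.IsHexagonalQuotient) (z : ℤ × ℤ) :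
    M.translation (-z) = (M.translation z)⁻¹ := by
  rw [eq_inv_iff_mul_eq_one, ← h.translation_add, neg_add_cancel, translation_zero]

/-- It suffices to conjugate the two generators: 1 goes to ω = 1 + ω², and ω² goes to -1. -/
theorem next_mul_translation (h : M.IsHexagonalQuotient) (z : ℤ × ℤ) :
    M.next * M.translation z = M.translation (turn z) * M.next := by
  rw [← mul_inv_eq_iff_eq_mul]
  have e : M.next * M.translation z * M.next⁻¹ =
      (M.next * (M.opp * M.next ^ 3) * M.next⁻¹) ^ z.1 *
        (M.next * (M.next ^ 2 * M.opp * M.next) * M.next⁻¹) ^ z.2 := by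
    rw [conj_zpow, conj_zpow, translation]; group
  rw [e, ← translation_mul opp_mul_opp h.next_pow h.rot_pow',
    conj_translation opp_mul_opp h.next_pow, h.commute.mul_zpow, translation, turn, sub_eq_add_neg,
    zpow_add, inv_zpow']
  exact (h.commute.zpow_zpow (-z.2) z.1).symm.right_comm _

theorem next_translation (h : M.IsHexagonalQuotient) (z : ℤ × ℤ) (d : D) :
    M.next (M.translation z d) = M.translation (turn z) (M.next d) :=
  congrArg (· d) (h.next_mul_translation z)

theorem next_six (h : M.IsHexagonalQuotient) (d : D) :
    M.next (M.next (M.next (M.next (M.next (M.next d))))) = d :=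
  congrArg (· d) h.next_pow

theorem opp_eq (h : M.IsHexagonalQuotient) (d : D) :
    M.opp d = M.translation (1, 0) (M.next (M.next (M.next d))) := by
  rw [translation_one]
  change _ = M.opp (M.next (M.next (M.next _)))
  rw [h.next_six]

theorem translation_translation (h : M.IsHexagonalQuotient) (z w : ℤ × ℤ) (d : D) :
    M.translation z (M.translation w d) = M.translation (z + w) d :=
  (congrArg (· d) (h.translation_add z w)).symm

/-- The three-fold rotation about a vertex, in terms of translations. -/
theorem translation_next_next (h : M.IsHexagonalQuotient) (d : D) :
    M.rot (M.translation (1, 0) (M.next (M.next d))) = d := by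
  have : M.rot (M.opp (M.next (M.next (M.next (M.next (M.next d)))))) = d := h.next_six d
  rw [translation_one]
  exact this

/-- The translations that fix a dart. -/
def period (h : M.IsHexagonalQuotient) (d : D) : AddSubgroup (ℤ × ℤ) where
  carrier := {z | M.translation z d = d}
  zero_mem' := by simp [translation_zero]
  add_mem' {z w} hz hw := by
    simp only [Set.mem_ofPred_eq] at *
    rw [← h.translation_translation, hw, hz]
  neg_mem' {z} hz := by
    simp only [Set.mem_ofPred_eq] at *
    rw [h.translation_neg, Perm.inv_eq_iff_eq, hz]

theorem mem_period (h : M.IsHexagonalQuotient) {d : D} {z : ℤ × ℤ} :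
    z ∈ h.period d ↔ M.translation z d = d := Iff.rfl

theorem translation_eq_iff (h : M.IsHexagonalQuotient) {d : D} {z w : ℤ × ℤ} :
    M.translation z d = M.translation w d ↔ z - w ∈ h.period d := by
  rw [mem_period, sub_eq_neg_add, h.translation_add, h.translation_neg, Perm.mul_apply,
    Perm.inv_eq_iff_eq]

theorem mem_period_next (h : M.IsHexagonalQuotient) {d : D} {z : ℤ × ℤ} :
    turn z ∈ h.period (M.next d) ↔ z ∈ h.period d := by
  rw [mem_period, mem_period, ← h.next_translation, EmbeddingLike.apply_eq_iff_eq]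

/-- The half turn about the centre of a triangle. -/
theorem next_three_translation (h : M.IsHexagonalQuotient) {d : D}
    (hd : M.next (M.next (M.next d)) = d) (z : ℤ × ℤ) :
    M.next (M.next (M.next (M.translation z d))) = M.translation (-z) d := by
  rw [h.next_translation, h.next_translation, h.next_translation, hd]
  congr 2
  ext <;> simp [turn]
  ring

theorem opp_translation (h : M.IsHexagonalQuotient) {d : D}
    (hd : M.next (M.next (M.next d)) = d) (z : ℤ × ℤ) :
    M.opp (M.translation z d) = M.translation ((1, 0) - z) d := by
  rw [h.opp_eq, h.next_three_translation hd, h.translation_translation, sub_eq_add_neg]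

/-- On translates of `d`, `opp` is the reflection w ↦ (1, 0) - w. A period of this parity would put
a fixed point of it in the lattice, hence give a dart fixed by `opp`. -/
theorem not_mem_period_of_odd_even (h : M.IsHexagonalQuotient) {d : D}
    (hd : M.next (M.next (M.next d)) = d) {z : ℤ × ℤ} (hz : z ∈ h.period d) :
    ¬ (Odd z.1 ∧ Even z.2) := by
  rintro ⟨⟨x, hx⟩, y, hy⟩
  refine M.opp_ne (M.translation (-x, -y) d) ?_
  rw [h.opp_translation hd, h.translation_eq_iff]
  convert hz using 1
  ext <;> simp <;> lia

/-- `turn` permutes the three nonzero parity classes cyclically, so applying the previous lemma to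
each side of the triangle excludes all three. -/
theorem even_of_mem_period (h : M.IsHexagonalQuotient) {d : D}
    (hd : M.next (M.next (M.next d)) = d) {z : ℤ × ℤ} (hz : z ∈ h.period d) :
    Even z.1 ∧ Even z.2 := by
  have h1 := h.mem_period_next.2 hz
  have h2 := h.mem_period_next.2 h1
  have e0 := h.not_mem_period_of_odd_even hd hz
  have e1 := h.not_mem_period_of_odd_even (d := M.next d) (by rw [hd]) h1
  have e2 := h.not_mem_period_of_odd_even (d := M.next (M.next d)) (by rw [hd]) h2
  simp only [turn, Int.even_sub, ← Int.not_even_iff_odd] at e0 e1 e2 ⊢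
  tauto

/-- Consecutive darts of a face are not translates of each other, as the rotation relating them
would have a fixed point. -/
theorem next_ne_translation (h : M.IsHexagonalQuotient) (hf : ∀ d, M.next d ≠ d) (d : D)
    (z : ℤ × ℤ) : M.next d ≠ M.translation z d := by
  intro hz
  -- A fixed point needs w = ωw + z. As 1 - ω = ω⁻¹ is a unit, w = ωz solves it.
  apply hf (M.translation (z.1 - z.2, z.1) d)
  rw [h.next_translation, hz, h.translation_translation]
  congr 2
  ext <;> simp [turn]
  ring

/-- Here 1 - ω² has norm 3, so w = ω²w + z is solvable only if 3 divides z.1 + z.2. The other two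
residues give a fixed point of a rotation about one of the two kinds of vertex; these are the three
classes of threefold centres of the tiling. -/
theorem next_next_ne_translation (h : M.IsHexagonalQuotient) (hf : ∀ d, M.next (M.next d) ≠ d)
    (hr : ∀ d, M.rot d ≠ d) (d : D) (z : ℤ × ℤ) :
    M.next (M.next d) ≠ M.translation z d := by
  intro hz
  have key : ∀ w : ℤ × ℤ, M.next (M.next (M.translation w d)) =
      M.translation (turn (turn w) + z) d := fun w => by
    rw [h.next_translation, h.next_translation, hz, h.translation_translation]
  have hr' : ∀ e, M.translation (1, 0) (M.next (M.next e)) ≠ e := fun e he =>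
    hr e (by nth_rw 1 [← he]; exact h.translation_next_next e)
  have hr'' : ∀ e, M.translation (1, 1) (M.next (M.next e)) ≠ e := fun e he => by
    apply hr' (M.next.symm e)
    apply M.next.injective
    rw [h.next_translation]
    simpa [turn] using he
  obtain ⟨k, hk | hk | hk⟩ : ∃ k, z.1 + z.2 = 3 * k ∨ z.1 + z.2 = 3 * k - 1 ∨ z.1 + z.2 = 3 * k - 2 :=
    ⟨(z.1 + z.2 + 2) / 3, by lia⟩
  · apply hf (M.translation (z.1 - k, k) d)
    rw [key]
    congr 2
    ext <;> simp [turn] <;> lia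
  · apply hr' (M.translation (z.1 + 1 - k, k) d)
    rw [key, h.translation_translation]
    congr 2
    ext <;> simp [turn] <;> lia
  · apply hr'' (M.translation (z.1 + 1 - k, k) d)
    rw [key, h.translation_translation]
    congr 2
    ext <;> simp [turn] <;> lia

end IsHexagonalQuotient
end CombinatorialMap

/-! ### Consequences of the type 3_n conditions -/

namespace CombinatorialMap

variable {D : Type*} {M : CombinatorialMap D}

theorem faceSize_leftFace [Finite D] (d : D) :
    M.faceSize (M.leftFace d) = Function.minimalPeriod M.next d :=
  card_sameCycle_fiber M.next d

theorem degree_tail [Finite D] (d : D) :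
    M.degree (M.tail d) = Function.minimalPeriod M.rot d :=
  card_sameCycle_fiber M.rot d

theorem tail_eq_iff [Finite D] {d e : D} (h : M.rot (M.rot (M.rot d)) = d) :
    M.tail e = M.tail d ↔ e = d ∨ e = M.rot d ∨ e = M.rot (M.rot d) := by
  have h3 : Function.IsPeriodicPt M.rot 3 d := h
  constructor
  · intro he
    have : M.rot.SameCycle d e := (Quotient.exact he).symm
    obtain ⟨i, hi⟩ := this.exists_nat_pow_eq
    rw [← Perm.iterate_eq_pow] at hi
    rw [← hi, ← h3.iterate_mod_apply i]
    have : i % 3 < 3 := Nat.mod_lt _ (by norm_num)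
    interval_cases i % 3
    · exact Or.inl rfl
    · exact Or.inr (Or.inl rfl)
    · exact Or.inr (Or.inr rfl)
  · rintro (rfl | rfl | rfl)
    · rfl
    · exact Quotient.sound (Perm.SameCycle.refl _ _).apply_left
    · exact Quotient.sound (Perm.SameCycle.refl _ _).apply_left.apply_left

theorem tail_rot (d : D) : M.tail (M.rot d) = M.tail d :=
  Quotient.sound (Perm.SameCycle.refl M.rot d).apply_left

theorem exists_tail_eq (v : M.Vertex) : ∃ d, M.tail d = v := Quotient.exists_rep v

/-- In a connected map, a property of darts that is preserved by `rot` and `opp` holds for all darts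
if it holds for one. -/
theorem dart_induction [Finite D] (hM : M.skeleton.Connected) {P : D → Prop} (d₀ : D) (h₀ : P d₀)
    (hrot : ∀ d, P d → P (M.rot d)) (hopp : ∀ d, P d → P (M.opp d)) (d : D) : P d := by
  have hcycle : ∀ d e, M.tail d = M.tail e → P d → P e := by
    intro d e hde hd
    obtain ⟨i, hi⟩ := (Quotient.exact hde : M.rot.SameCycle d e).exists_nat_pow_eq
    rw [← hi]
    clear hi
    induction i with
    | zero => exact hd
    | succ i ih => rw [pow_succ', Perm.mul_apply]; exact hrot _ ih
  obtain ⟨w⟩ := hM.preconnected (M.tail d₀) (M.tail d)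
  suffices ∀ {u v : M.Vertex}, M.skeleton.Walk u v → (∀ d, M.tail d = u → P d) →
      ∀ d, M.tail d = v → P d from
    this w (fun e he => hcycle _ _ he.symm h₀) d rfl
  intro u v w
  induction w with
  | nil => exact id
  | cons huv _ ih =>
    intro hu
    refine ih fun e he => ?_
    obtain ⟨-, x, hx, hx'⟩ := huv
    exact hcycle _ _ (hx'.trans he.symm) (hopp _ (hu x hx))

/-- The skeleton of a cubic map is not `3`-connected when two triangles share an edge, unless there
are at most four vertices. -/
theorem card_vertex_le_four [Finite D] (hrot : ∀ d, M.rot (M.rot (M.rot d)) = d) (hs : M.IsSimple)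
    (hc : IsThreeConnected M.skeleton) {e : D} (he : M.next (M.next (M.next e)) = e)
    (he' : M.next (M.next (M.next (M.opp e))) = M.opp e) : Nat.card M.Vertex ≤ 4 := by
  classical
  have hinv : ∀ d, M.rot (M.opp (M.next (M.next d))) = M.next (M.next (M.next d)) := fun _ => rfl
  have key : ∀ e, M.next (M.next (M.next e)) = e →
      M.next (M.next (M.next (M.opp e))) = M.opp e → ∀ x, M.tail x = M.tail e →
      M.tail (M.opp x) = M.tail (M.opp e) ∨ M.tail (M.opp x) = M.tail (M.next (M.next e)) ∨
        M.tail (M.opp x) = M.tail (M.next (M.next (M.opp e))) := by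
    intro e he he' x hx
    rcases (tail_eq_iff (hrot e)).1 hx with rfl | rfl | rfl
    · exact Or.inl rfl
    · right; right
      have : M.next (M.opp e) = M.rot e := congrArg M.rot (M.opp_opp e)
      rw [this]
      exact (tail_rot _).symm
    · right; left
      have : M.rot (M.rot e) = M.opp (M.next (M.next e)) := by
        apply M.rot.injective
        rw [hrot, hinv, he]
      rw [this, M.opp_opp]
  set b := M.tail e with hb
  set c := M.tail (M.opp e) with hc'
  set p := M.tail (M.next (M.next e)) with hp
  set q := M.tail (M.next (M.next (M.opp e))) with hq
  have hbp : b ≠ p := by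
    have := hs.1 (M.next (M.next e))
    rwa [← tail_rot, hinv, he] at this
  have hbq : b ≠ q := by
    have h1 := hs.1 (M.rot e)
    have : M.next (M.opp e) = M.rot e := congrArg M.rot (M.opp_opp e)
    rw [hq, this]
    have h2 : M.tail (M.next (M.rot e)) = M.tail (M.opp (M.rot e)) := tail_rot _
    rw [h2]
    rw [tail_rot] at h1
    exact h1.symm
  -- The apexes p, q of the two triangles are the only neighbours of the common edge bc outside it,
  -- so deleting them cuts b and c off from any other vertex.
  have hcon := hc.2 {p, q} (lt_of_le_of_lt (Set.encard_insert_le _ _) (by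
    rw [Set.encard_singleton]; norm_num))
  have hall : ∀ v : ({p, q}ᶜ : Set M.Vertex), v.1 = b ∨ v.1 = c := by
    intro v
    obtain ⟨w⟩ := hcon.preconnected ⟨b, by simp [hbp, hbq]⟩ v
    suffices ∀ {u v : ({p, q}ᶜ : Set M.Vertex)}, (M.skeleton.induce {p, q}ᶜ).Walk u v →
        (u.1 = b ∨ u.1 = c) → (v.1 = b ∨ v.1 = c) from this w (Or.inl rfl)
    intro u v w
    induction w with
    | nil => exact id
    | @cons u v w huv _ ih =>
      intro hu
      apply ih
      obtain ⟨-, x, hx, hx'⟩ := huv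
      simp only [Function.Embedding.subtype_apply] at hx hx'
      have hv := v.2
      simp only [Set.mem_compl_iff, Set.mem_insert_iff, Set.mem_singleton_iff, not_or] at hv
      rcases hu with hu | hu
      · have := key e he he' x (hx.trans hu)
        rw [hx'] at this
        tauto
      · have := key (M.opp e) he' (by rw [M.opp_opp, he]) x (hx.trans hu)
        rw [hx', M.opp_opp] at this
        tauto
  have huniv : (Set.univ : Set M.Vertex) ⊆ (({b, c, p, q} : Finset M.Vertex) : Set M.Vertex) := by
    intro v _
    by_cases hv : v ∈ ({p, q} : Set M.Vertex)
    · simp at hv ⊢; tauto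
    · have := hall ⟨v, hv⟩
      simp at this ⊢; tauto
  calc Nat.card M.Vertex = (Set.univ : Set M.Vertex).ncard := (Set.ncard_univ _).symm
    _ ≤ _ := Set.ncard_le_ncard huniv (Finset.finite_toSet _)
    _ ≤ 4 := by rw [Set.ncard_coe_finset]; exact Finset.card_le_four

namespace IsTypeThree

variable {n : ℕ} [Finite D]

theorem minimalPeriod_next (h : M.IsTypeThree n) (d : D) :
    Function.minimalPeriod M.next d = 3 ∨ Function.minimalPeriod M.next d = 6 := by
  simpa only [faceSize_leftFace] using h.faceSize_eq (M.leftFace d)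

theorem minimalPeriod_rot (h : M.IsTypeThree n) (d : D) :
    Function.minimalPeriod M.rot d = 3 := by
  simpa only [degree_tail] using h.degree_eq (M.tail d)

theorem rot_rot_rot (h : M.IsTypeThree n) (d : D) : M.rot (M.rot (M.rot d)) = d := by
  have := Function.iterate_minimalPeriod (f := M.rot) (x := d)
  rw [h.minimalPeriod_rot] at this
  exact this

theorem rot_ne (h : M.IsTypeThree n) (d : D) : M.rot d ≠ d := fun hd => by
  have := Function.IsPeriodicPt.minimalPeriod_dvd (f := M.rot) (n := 1) (x := d) hd
  rw [h.minimalPeriod_rot] at this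
  norm_num at this

theorem next_ne (h : M.IsTypeThree n) (d : D) : M.next d ≠ d := fun hd => by
  have := Function.IsPeriodicPt.minimalPeriod_dvd (f := M.next) (n := 1) (x := d) hd
  rcases h.minimalPeriod_next d with h | h <;> rw [h] at this <;> norm_num at this

theorem next_next_ne (h : M.IsTypeThree n) (d : D) : M.next (M.next d) ≠ d := fun hd => by
  have := Function.IsPeriodicPt.minimalPeriod_dvd (f := M.next) (n := 2) (x := d) hd
  rcases h.minimalPeriod_next d with h | h <;> rw [h] at this <;> norm_num at this

theorem next_next_next_eq_iff (h : M.IsTypeThree n) (d : D) :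
    M.next (M.next (M.next d)) = d ↔ M.faceSize (M.leftFace d) = 3 := by
  rw [faceSize_leftFace]
  constructor
  · intro hd
    have := Function.IsPeriodicPt.minimalPeriod_dvd (f := M.next) (n := 3) (x := d) hd
    rcases h.minimalPeriod_next d with h | h
    · exact h
    · rw [h] at this; norm_num at this
  · intro hd
    have := Function.iterate_minimalPeriod (f := M.next) (x := d)
    rw [hd] at this
    exact this

theorem isHexagonalQuotient (h : M.IsTypeThree n) : M.IsHexagonalQuotient where
  next_pow := by
    ext d
    have h6 : Function.IsPeriodicPt M.next 6 d := by
      rw [Function.isPeriodicPt_iff_minimalPeriod_dvd]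
      rcases h.minimalPeriod_next d with h | h <;> rw [h] <;> norm_num
    exact h6
  rot_pow := by
    ext d
    exact h.rot_rot_rot d

theorem card_dart (h : M.IsTypeThree n) : Nat.card D = n * 3 := by
  rw [← h.card_vertex]
  exact (card_quotient_mul _ 3 h.degree_eq).symm

/-- Up to rotation, every dart is a translate of a given dart of a triangle. -/
theorem exists_eq_translation (h : M.IsTypeThree n) {d₀ : D} (h₀ : M.next (M.next (M.next d₀)) = d₀)
    (d : D) : ∃ z, d = M.translation z d₀ ∨ d = M.next (M.translation z d₀) ∨
      d = M.next (M.next (M.translation z d₀)) := by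
  have hh := h.isHexagonalQuotient
  have hnext : ∀ d, (∃ z, d = M.translation z d₀ ∨ d = M.next (M.translation z d₀) ∨
      d = M.next (M.next (M.translation z d₀))) → (∃ z, M.next d = M.translation z d₀ ∨
      M.next d = M.next (M.translation z d₀) ∨
      M.next d = M.next (M.next (M.translation z d₀))) := by
    rintro d ⟨z, rfl | rfl | rfl⟩
    · exact ⟨z, Or.inr (Or.inl rfl)⟩
    · exact ⟨z, Or.inr (Or.inr rfl)⟩
    · exact ⟨-z, Or.inl (hh.next_three_translation h₀ z)⟩
  have hopp : ∀ d, (∃ z, d = M.translation z d₀ ∨ d = M.next (M.translation z d₀) ∨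
      d = M.next (M.next (M.translation z d₀))) → (∃ z, M.opp d = M.translation z d₀ ∨
      M.opp d = M.next (M.translation z d₀) ∨
      M.opp d = M.next (M.next (M.translation z d₀))) := by
    rintro d ⟨z, rfl | rfl | rfl⟩
    · exact ⟨_, Or.inl (hh.opp_translation h₀ z)⟩
    -- `opp` reflects in (1, 0) relative to the rotated dart; `(0, -1)` here and `(-1, -1)` below
    -- are (1, 0) turned back once and twice.
    · refine ⟨(0, -1) - z, Or.inr (Or.inl ?_)⟩
      rw [hh.next_translation, hh.opp_translation (by rw [h₀]), hh.next_translation]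
      congr 2
      ext <;> simp [turn]; ring
    · refine ⟨(-1, -1) - z, Or.inr (Or.inr ?_)⟩
      rw [hh.next_translation, hh.next_translation, hh.opp_translation (by rw [h₀]),
        hh.next_translation, hh.next_translation]
      congr 2
      ext <;> simp [turn] <;> ring
  refine dart_induction h.polyhedral.2.1.1 d₀ ⟨0, Or.inl (by simp [translation_zero])⟩
    (fun d hd => ?_) hopp d
  have := hnext _ (hopp _ hd)
  rwa [show M.next (M.opp d) = M.rot d from congrArg M.rot (M.opp_opp d)] at this

/-- The darts biject with (ℤ² / N) × `Fin 3`: the three classes are disjoint because `next` and its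
square never act on a dart as a translation. There are 3n darts. -/
theorem index_period (h : M.IsTypeThree n) {d₀ : D} (h₀ : M.next (M.next (M.next d₀)) = d₀) :
    (h.isHexagonalQuotient.period d₀).index = n := by
  have hh := h.isHexagonalQuotient
  set N := hh.period d₀
  let F : (ℤ × ℤ) ⧸ N → D := Quotient.lift (fun z => M.translation z d₀) (by
    intro z w hzw
    have := QuotientAddGroup.leftRel_apply.1 hzw
    have h2 : M.translation w d₀ = M.translation z d₀ := by
      rw [hh.translation_eq_iff, sub_eq_neg_add]; exact this
    exact h2.symm)
  have hF : ∀ z : ℤ × ℤ, F z = M.translation z d₀ := fun z => rfl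
  have hinj : ∀ a b, F a = F b → a = b := by
    intro a b
    induction a using QuotientAddGroup.induction_on with | H z => ?_
    induction b using QuotientAddGroup.induction_on with | H w => ?_
    rw [hF, hF, eq_comm, hh.translation_eq_iff]
    intro hzw
    rw [QuotientAddGroup.eq, neg_add_eq_sub]
    exact hzw
  let G : ((ℤ × ℤ) ⧸ N) × Fin 3 → D := fun x => (M.next)^[x.2] (F x.1)
  have n1 : ∀ a b, M.next (F a) ≠ F b := by
    intro a b
    induction a using QuotientAddGroup.induction_on with | H z => ?_
    induction b using QuotientAddGroup.induction_on with | H w => ?_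
    rw [hF, hF, show w = (w - z) + z by abel, ← hh.translation_translation]
    exact hh.next_ne_translation h.next_ne _ _
  have n2 : ∀ a b, M.next (M.next (F a)) ≠ F b := by
    intro a b
    induction a using QuotientAddGroup.induction_on with | H z => ?_
    induction b using QuotientAddGroup.induction_on with | H w => ?_
    rw [hF, hF, show w = (w - z) + z by abel, ← hh.translation_translation]
    exact hh.next_next_ne_translation h.next_next_ne h.rot_ne _ _
  have hG : Function.Bijective G := by
    constructor
    · rintro ⟨a, i⟩ ⟨b, j⟩ hab
      have inj := M.next.injective
      fin_cases i <;> fin_cases j <;> simp [G] at hab ⊢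
      · exact hinj _ _ hab
      · exact n1 _ _ hab.symm
      · exact n2 _ _ hab.symm
      · exact n1 _ _ hab
      · exact hinj _ _ hab
      · exact n1 _ _ hab.symm
      · exact n2 _ _ hab
      · exact n1 _ _ hab
      · exact hinj _ _ hab
    · intro d
      obtain ⟨z, rfl | rfl | rfl⟩ := h.exists_eq_translation h₀ d
      · exact ⟨(z, 0), rfl⟩
      · exact ⟨(z, 1), rfl⟩
      · exact ⟨(z, 2), rfl⟩
  have hcard := Nat.card_eq_of_bijective G hG
  rw [h.card_dart, Nat.card_prod, Nat.card_fin] at hcard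
  exact Nat.eq_of_mul_eq_mul_right (by norm_num) hcard

end IsTypeThree

end CombinatorialMap

/-! ### Index computations for lattices -/

/-- A subgroup of `ℤ × ℤ` all of whose elements are divisible by two has four times the index of
the subgroup of their halves. -/
theorem index_eq_four_mul_index_comap (N : AddSubgroup (ℤ × ℤ))
    (hN : ∀ z ∈ N, Even z.1 ∧ Even z.2) :
    N.index = 4 * (N.comap (nsmulAddMonoidHom 2)).index := by
  have hle : N ≤ (nsmulAddMonoidHom (α := ℤ × ℤ) 2).range := by
    intro z hz
    obtain ⟨⟨x, hx⟩, y, hy⟩ := hN z hz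
    exact ⟨(x, y), by ext <;> simp <;> lia⟩
  have hr : (nsmulAddMonoidHom (α := ℤ × ℤ) 2).range =
      (AddSubgroup.zmultiples (2 : ℤ)).prod (AddSubgroup.zmultiples (2 : ℤ)) := by
    ext ⟨x, y⟩
    simp only [AddMonoidHom.mem_range, nsmulAddMonoidHom_apply, Prod.exists, AddSubgroup.mem_prod,
      Int.mem_zmultiples_iff]
    constructor
    · rintro ⟨a, b, h⟩
      simp at h
      exact ⟨⟨a, h.1.symm⟩, b, h.2.symm⟩
    · rintro ⟨⟨a, rfl⟩, b, rfl⟩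
      exact ⟨a, b, by simp⟩
  rw [AddSubgroup.index_comap, ← AddSubgroup.relIndex_mul_index hle, hr, AddSubgroup.index_prod,
    Int.index_zmultiples]
  simp; ring

/-- If a coset of `ℤ u` misses a subgroup of prime index then `u` lies in the subgroup. -/
theorem mem_of_index_prime {A : Type*} [AddCommGroup A] {L : AddSubgroup A} (hL : L.index.Prime)
    {z u : A} (h : ∀ i : ℤ, z + i • u ∉ L) : u ∈ L := by
  have hle : L ≤ L ⊔ AddSubgroup.zmultiples u := le_sup_left
  have hmul := AddSubgroup.relIndex_mul_index hle
  rw [← hmul, Nat.prime_mul_iff] at hL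
  rcases hL with ⟨-, h1⟩ | ⟨-, h1⟩
  · exfalso
    rw [AddSubgroup.index_eq_one] at h1
    have hz : z ∈ L ⊔ AddSubgroup.zmultiples u := h1 ▸ AddSubgroup.mem_top z
    obtain ⟨y, hy, w, hw, hyw⟩ := AddSubgroup.mem_sup.1 hz
    obtain ⟨i, rfl⟩ := AddSubgroup.mem_zmultiples_iff.1 hw
    apply h (-i)
    rw [← hyw]
    simpa using hy
  · rw [AddSubgroup.relIndex_eq_one] at h1
    exact h1 (AddSubgroup.mem_sup_right (AddSubgroup.mem_zmultiples u))

/-! ### Prime n/4 forces tightness -/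

namespace CombinatorialMap

theorem IsTypeThree.isTight {D : Type*} [Finite D] {M : CombinatorialMap D} {n : ℕ}
    (h : M.IsTypeThree n) (hn : 4 < n) (hp : (n / 4).Prime) : M.IsTight := by
  refine ⟨fun R => ?_⟩
  have hh := h.isHexagonalQuotient
  -- The side of the triangle is chosen parallel to the entry dart, so that the railroad consists of
  -- pure translates of it in direction `(1, 0)`.
  obtain ⟨d₁, z, h₁, hz⟩ : ∃ d₁ z, M.next (M.next (M.next d₁)) = d₁ ∧
      R.entry 0 = M.translation z d₁ := by
    obtain ⟨f, hf⟩ := h.exists_triangle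
    obtain ⟨d₀, rfl⟩ : ∃ d, M.leftFace d = f := Quotient.exists_rep f
    have h₀ := (h.next_next_next_eq_iff d₀).2 hf
    obtain ⟨z, hz | hz | hz⟩ := h.exists_eq_translation h₀ (R.entry 0)
    · exact ⟨d₀, z, h₀, hz⟩
    · exact ⟨M.next d₀, turn z, by rw [h₀], by rw [hz, hh.next_translation]⟩
    · exact ⟨M.next (M.next d₀), turn (turn z), by rw [h₀],
        by rw [hz, hh.next_translation, hh.next_translation]⟩
  have hstep : ∀ i, R.entry (i + 1) = M.translation (1, 0) (R.entry i) := fun i => by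
    rw [R.step, translation_one]; rfl
  have hentry : ∀ i : ℤ, R.entry i = M.translation (z + i • (1, 0)) d₁ := by
    intro i
    induction i with
    | zero => simpa using hz
    | succ i ih =>
      push_cast at ih ⊢
      rw [hstep, ih, hh.translation_translation]
      congr 2
      ext <;> simp; ring
    | pred i ih =>
      apply (M.translation (1, 0)).injective
      rw [← hstep, hh.translation_translation]
      push_cast at ih ⊢
      rw [sub_add_cancel, ih]
      congr 2
      ext <;> simp; ring
  set L := (hh.period d₁).comap (nsmulAddMonoidHom 2) with hLdef
  have hmem : ∀ w, w ∈ L ↔ M.next (M.next (M.next (M.translation w d₁))) = M.translation w d₁ := by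
    intro w
    rw [hh.next_three_translation h₁, eq_comm, hh.translation_eq_iff, hLdef,
      AddSubgroup.mem_comap, nsmulAddMonoidHom_apply, two_nsmul, sub_neg_eq_add]
  have hL : L.index.Prime := by
    have h1 := index_eq_four_mul_index_comap (hh.period d₁)
      fun w hw => hh.even_of_mem_period h₁ hw
    rw [h.index_period h₁] at h1
    rwa [h1, Nat.mul_div_cancel_left _ (by norm_num)] at hp
  have hu : ((1, 0) : ℤ × ℤ) ∈ L := by
    refine mem_of_index_prime hL (z := z) fun i hi => ?_
    rw [hmem, h.next_next_next_eq_iff, ← hentry, R.hexagonal] at hi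
    norm_num at hi
  rw [hmem] at hu
  have hopp : M.translation (1, 0) d₁ = M.opp d₁ := by
    rw [hh.opp_eq, h₁]
  rw [hopp] at hu
  have := card_vertex_le_four h.rot_rot_rot h.polyhedral.1 h.polyhedral.2.2 h₁ hu
  rw [h.card_vertex] at this
  lia

end CombinatorialMap

/-! ### Rings with one vertex removed -/

section Ring

variable {A : Type*} [AddCommGroup A] {S : Set A} {r : A → A → Prop} {e f : A}

/-- Walking along `u, f - u, u + e, f - u - e, …` without meeting `S`. -/
theorem reachable_along_ring (hrefl : ∀ u ∉ S, r u u) (htrans : ∀ u v w, r u v → r v w → r u w)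
    (h1 : ∀ u ∉ S, f - u ∉ S → r u (f - u)) (h2 : ∀ u ∉ S, e + f - u ∉ S → r u (e + f - u))
    (w : A) (m : ℕ) (hS : ∀ i < m, (0 < i → w + i • e ∉ S) ∧ f - w - i • e ∉ S) :
    ∀ i < m, (0 < i → r (f - w) (w + i • e)) ∧ r (f - w) (f - w - i • e) := by
  intro i
  induction i with
  | zero =>
    intro hm
    have := (hS 0 hm).2
    simp only [zero_smul, sub_zero] at this
    simpa using hrefl _ this
  | succ i ih =>
    intro hm
    have e1 := (ih (by lia)).2
    have n0 := (hS i (by lia)).2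
    have n1 := (hS (i + 1) hm).1 (by lia)
    have n2 := (hS (i + 1) hm).2
    have e2 : r (f - w - i • e) (w + (i + 1) • e) := by
      have : e + f - (f - w - i • e) = w + (i + 1) • e := by rw [succ_nsmul]; abel
      rw [← this]
      exact h2 _ n0 (this ▸ n1)
    have e3 : r (w + (i + 1) • e) (f - w - (i + 1) • e) := by
      have : f - (w + (i + 1) • e) = f - w - (i + 1) • e := by abel
      rw [← this]
      exact h1 _ n1 (this ▸ n2)
    exact ⟨fun _ => htrans _ _ _ e1 e2, htrans _ _ _ (htrans _ _ _ e1 e2) e3⟩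

/-- A closed ring that meets `S` at most in the point `w` is connected outside `S`. -/
theorem reachable_in_ring (hrefl : ∀ u ∉ S, r u u) (hsymm : ∀ u v, r u v → r v u)
    (htrans : ∀ u v w, r u v → r v w → r u w)
    (h1 : ∀ u ∉ S, f - u ∉ S → r u (f - u)) (h2 : ∀ u ∉ S, e + f - u ∉ S → r u (e + f - u))
    (w : A) (m : ℕ) (he : ∀ i, 0 < i → i < m → i • e ≠ 0)
    (hodd : ∀ i : ℕ, f - w - i • e ≠ w)
    (hS : ∀ i < m, (w + i • e ∈ S → w + i • e = w) ∧ (f - w - i • e ∈ S → f - w - i • e = w))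
    {u : A} (huS : u ∉ S) (hu : ∃ i < m, u = w + i • e ∨ u = f - w - i • e) : r (f - w) u := by
  -- The walk starts at the neighbour f - w just past w and goes once round; `he` and `hodd` keep it
  -- from returning to w, the only possible obstacle.
  have key := reachable_along_ring hrefl htrans h1 h2 w m fun i hi =>
    ⟨fun h0 hw => he i h0 hi (by simpa using (hS i hi).1 hw), fun hw => hodd i ((hS i hi).2 hw)⟩
  obtain ⟨i, hi, rfl | rfl⟩ := hu
  -- The walk never reaches w itself; if w is not removed, it is adjacent to the start.
  · rcases Nat.eq_zero_or_pos i with rfl | h0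
    · simp only [zero_smul, add_zero] at huS ⊢
      refine hsymm _ _ (h1 w huS fun hw => hodd 0 ?_)
      have := (hS 0 hi).2
      simpa using this (by simpa using hw)
    · exact (key i hi).1 h0
  · exact (key i hi).2

end Ring

/-! ### Doubling and reflection in cyclic groups of even order -/

namespace ZMod

theorem two_mul_ne_one (a : ℕ) (x : ZMod (2 * a)) : 2 * x ≠ 1 := by
  intro h
  have := congrArg (ZMod.castHom (Dvd.intro a rfl) (ZMod 2)) h
  rw [map_mul, map_one, map_ofNat] at this
  have h2 : ((2 : ℕ) : ZMod 2) = 0 := ZMod.natCast_self 2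
  norm_num at h2
  rw [h2, zero_mul] at this
  exact zero_ne_one this

theorem two_ne_zero_of_two_le {a : ℕ} (ha : 2 ≤ a) : (2 : ZMod (2 * a)) ≠ 0 := by
  intro h
  have : ((2 : ℕ) : ZMod (2 * a)) = 0 := by exact_mod_cast h
  rw [ZMod.natCast_eq_zero_iff] at this
  have := Nat.le_of_dvd (by norm_num) this
  lia

theorem card_two_mul_eq (a : ℕ) [NeZero a] (c : ZMod (2 * a)) :
    Nat.card {x : ZMod (2 * a) // 2 * x = 2 * c} = 2 := by
  have ha : 0 < a := NeZero.pos a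
  have h : ∀ x : ZMod (2 * a), 2 * x = 2 * c ↔ x = c ∨ x = c + a := by
    intro x
    obtain ⟨y, rfl⟩ : ∃ y, x = c + y := ⟨x - c, by ring⟩
    rw [mul_add, add_eq_left, add_eq_left, add_right_inj]
    have ha2 : (2 : ZMod (2 * a)) * a = 0 := by
      have := ZMod.natCast_self (2 * a)
      push_cast at this
      exact this
    constructor
    · intro hy
      have hv := ZMod.natCast_zmod_val y
      have hlt := ZMod.val_lt y
      rw [← hv] at hy ⊢
      have h2 : ((2 * y.val : ℕ) : ZMod (2 * a)) = 0 := by push_cast; exact hy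
      rw [ZMod.natCast_eq_zero_iff] at h2
      obtain ⟨k, hk⟩ := Nat.dvd_of_mul_dvd_mul_left (by norm_num) h2
      rw [hk] at hlt ⊢
      have : k < 2 := by
        by_contra hk2
        have : a * 2 ≤ a * k := Nat.mul_le_mul_left a (by lia)
        lia
      interval_cases k <;> simp
    · rintro (rfl | rfl)
      · simp
      · exact ha2
  have hne : c ≠ c + a := by
    intro h
    rw [left_eq_add, ZMod.natCast_eq_zero_iff] at h
    have := Nat.le_of_dvd ha h
    lia
  have : {x : ZMod (2 * a) | 2 * x = 2 * c} = {c, c + a} := Set.ext h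
  change Nat.card ({x : ZMod (2 * a) | 2 * x = 2 * c} : Set _) = 2
  rw [this, Nat.card_coe_set_eq, Set.ncard_pair hne]

end ZMod

section Reflection

variable {R : Type*} [CommRing R]

theorem exists_ne_and_ne_one_sub (h2 : (2 : R) ≠ 0) (p : R) :
    ∃ y, ¬ (p = y ∨ p = 1 - y) := by
  have h0 : (1 : R) ≠ 0 := fun h => h2 (by linear_combination 2 * h)
  by_cases h : 2 * p = 0
  · refine ⟨p - 1, ?_⟩
    rintro (h' | h')
    · exact h0 (by linear_combination h')
    · exact h2 (by linear_combination h - h')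
  · refine ⟨p + 1, ?_⟩
    rintro (h' | h')
    · exact h0 (by linear_combination -h')
    · exact h (by linear_combination h')

/-- Used to leave a blocked ring: crossing an edge from u can negate a coordinate, and the ring
reached then avoids every deleted vertex lying on the old one. -/
theorem ne_neg_and_ne_one_sub_neg (h1 : ∀ x : R, 2 * x ≠ 1) {u p : R} (hu : 2 * u ≠ 0)
    (hp : p = u ∨ p = 1 - u) : ¬ (p = -u ∨ p = 1 - -u) := by
  have h0 : (1 : R) ≠ 0 := fun h => h1 0 (by rw [h, mul_zero])
  rcases hp with rfl | rfl
  · rintro (h | h)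
    · exact hu (by linear_combination h)
    · exact h0 (by linear_combination -h)
  · rintro (h | h)
    · exact h0 (by linear_combination h)
    · exact hu (by linear_combination -h)

end Reflection

/-! ### The sum graph is 3-connected -/

theorem not_three_distinct {α : Type*} {p q x y z : α} (hx : x = p ∨ x = q) (hy : y = p ∨ y = q)
    (hz : z = p ∨ z = q) (hxy : x ≠ y) (hxz : x ≠ z) (hyz : y ≠ z) : False := by
  grind

/-- The graph on `ℤ/2a × ℤ/2b` in which vertices are adjacent when their sum is `(1, 0)`, `(0, 1)`
or `(1, 1)`. -/
def sumGraph (a b : ℕ) : SimpleGraph (ZMod (2 * a) × ZMod (2 * b)) where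
  Adj u v := u ≠ v ∧ (v = (1, 0) - u ∨ v = (0, 1) - u ∨ v = (1, 1) - u)
  symm := ⟨by
    rintro u v ⟨hne, h⟩
    refine ⟨hne.symm, ?_⟩
    rcases h with rfl | rfl | rfl <;> simp⟩
  loopless := ⟨fun _ h => h.1 rfl⟩

namespace sumGraph

variable {a b : ℕ}

theorem adj_one_zero (u : ZMod (2 * a) × ZMod (2 * b)) : (sumGraph a b).Adj u ((1, 0) - u) :=
  ⟨fun h => ZMod.two_mul_ne_one a u.1 (by
    have := congrArg Prod.fst h; simp at this; linear_combination this), Or.inl rfl⟩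

theorem adj_zero_one (u : ZMod (2 * a) × ZMod (2 * b)) : (sumGraph a b).Adj u ((0, 1) - u) :=
  ⟨fun h => ZMod.two_mul_ne_one b u.2 (by
    have := congrArg Prod.snd h; simp at this; linear_combination this), Or.inr (Or.inl rfl)⟩

theorem adj_one_one (u : ZMod (2 * a) × ZMod (2 * b)) : (sumGraph a b).Adj u ((1, 1) - u) :=
  ⟨fun h => ZMod.two_mul_ne_one b u.2 (by
    have := congrArg Prod.snd h; simp at this; linear_combination this), Or.inr (Or.inr rfl)⟩

/-- A ring not containing both p and q stays connected outside S. A row ring and a column ring meet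
in the four points {x, 1 - x} × {y, 1 - y}, of which at most two are deleted. So all such good rings
hang together, and it remains to bring each vertex onto one, in at most two steps. -/
theorem exists_hub (ha : 2 ≤ a) (hb : 2 ≤ b) {S : Set (ZMod (2 * a) × ZMod (2 * b))}
    {p q : ZMod (2 * a) × ZMod (2 * b)} (hS : S ⊆ {p, q})
    {r : ZMod (2 * a) × ZMod (2 * b) → ZMod (2 * a) × ZMod (2 * b) → Prop}
    (hrefl : ∀ u ∉ S, r u u) (hsymm : ∀ u v, r u v → r v u)
    (htrans : ∀ u v w, r u v → r v w → r u w)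
    (hadj : ∀ u v, u ∉ S → v ∉ S → (sumGraph a b).Adj u v → r u v) :
    ∃ h ∉ S, ∀ u ∉ S, r u h := by
  have o1 := ZMod.two_mul_ne_one a
  have o2 := ZMod.two_mul_ne_one b
  have t1 := ZMod.two_ne_zero_of_two_le ha
  have t2 := ZMod.two_ne_zero_of_two_le hb
  have i1 : (1 : ZMod (2 * a)) ≠ 0 := fun h => t1 (by linear_combination 2 * h)
  have i2 : (1 : ZMod (2 * b)) ≠ 0 := fun h => t2 (by linear_combination 2 * h)
  have : NeZero (2 * a) := ⟨by lia⟩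
  have : NeZero (2 * b) := ⟨by lia⟩
  have hS' : ∀ u, u ∈ S → u = p ∨ u = q := fun u hu => hS hu
  have a1 : ∀ u ∉ S, (1, 0) - u ∉ S → r u ((1, 0) - u) :=
    fun u hu hv => hadj _ _ hu hv (adj_one_zero u)
  have a2 : ∀ u ∉ S, (0, 1) - u ∉ S → r u ((0, 1) - u) :=
    fun u hu hv => hadj _ _ hu hv (adj_zero_one u)
  have a3 : ∀ u ∉ S, (1, 1) - u ∉ S → r u ((1, 1) - u) :=
    fun u hu hv => hadj _ _ hu hv (adj_one_one u)
  -- the rings in the two directions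
  let row (y : ZMod (2 * b)) (u : ZMod (2 * a) × ZMod (2 * b)) : Prop := u.2 = y ∨ u.2 = 1 - y
  let col (x : ZMod (2 * a)) (u : ZMod (2 * a) × ZMod (2 * b)) : Prop := u.1 = x ∨ u.1 = 1 - x
  have hrow : ∀ y, ¬ (row y p ∧ row y q) → ∀ u v, row y u → row y v → u ∉ S → v ∉ S → r u v := by
    intro y hy u v hu hv huS hvS
    -- w is the one vertex of the ring that may be deleted, or an arbitrary one if none is.
    obtain ⟨w, hw, hwS⟩ : ∃ w, row y w ∧ ∀ x, row y x → x ∈ S → x = w := by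
      by_cases hp : row y p
      · exact ⟨p, hp, fun x hx hxS => (hS' x hxS).resolve_right fun h => hy ⟨hp, h ▸ hx⟩⟩
      by_cases hq : row y q
      · exact ⟨q, hq, fun x hx hxS => (hS' x hxS).resolve_left fun h => hp (h ▸ hx)⟩
      · exact ⟨(0, y), Or.inl rfl, fun x hx hxS => by
          rcases hS' x hxS with rfl | rfl <;> contradiction⟩
    have key : ∀ u, row y u → u ∉ S → r ((0, 1) - w) u := by
      intro u hu huS
      refine reachable_in_ring (e := (1, 0)) hrefl hsymm htrans a2 (by simpa using a3) w (2 * a)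
        (fun i h0 hi h => ?_) (fun i h => o2 w.2 ?_) (fun i hi => ?_) huS ?_
      · have := congrArg Prod.fst h
        simp only [Prod.smul_mk, nsmul_eq_mul, mul_one, Prod.fst_zero] at this
        rw [ZMod.natCast_eq_zero_iff] at this
        exact absurd (Nat.le_of_dvd h0 this) (by lia)
      · have := congrArg Prod.snd h
        simp at this
        linear_combination -this
      · refine ⟨hwS _ ?_, hwS _ ?_⟩
        · simpa [row] using hw
        · rcases hw with hw | hw <;> simp [row, hw]
      · have huw : u.2 = w.2 ∨ u.2 = 1 - w.2 := by
          rcases hu with hu | hu <;> rcases hw with hw | hw <;> simp [hu, hw]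
        rcases huw with huw | huw
        · refine ⟨(u.1 - w.1).val, ZMod.val_lt _, Or.inl ?_⟩
          ext <;> simp [huw]
        · refine ⟨(-w.1 - u.1).val, ZMod.val_lt _, Or.inr ?_⟩
          ext <;> simp [huw]
    exact htrans _ _ _ (hsymm _ _ (key u hu huS)) (key v hv hvS)
  have hcol : ∀ x, ¬ (col x p ∧ col x q) → ∀ u v, col x u → col x v → u ∉ S → v ∉ S → r u v := by
    intro y hy u v hu hv huS hvS
    obtain ⟨w, hw, hwS⟩ : ∃ w, col y w ∧ ∀ x, col y x → x ∈ S → x = w := by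
      by_cases hp : col y p
      · exact ⟨p, hp, fun x hx hxS => (hS' x hxS).resolve_right fun h => hy ⟨hp, h ▸ hx⟩⟩
      by_cases hq : col y q
      · exact ⟨q, hq, fun x hx hxS => (hS' x hxS).resolve_left fun h => hp (h ▸ hx)⟩
      · exact ⟨(y, 0), Or.inl rfl, fun x hx hxS => by
          rcases hS' x hxS with rfl | rfl <;> contradiction⟩
    have key : ∀ u, col y u → u ∉ S → r ((1, 0) - w) u := by
      intro u hu huS
      refine reachable_in_ring (e := (0, 1)) hrefl hsymm htrans a1 (by simpa using a3) w (2 * b)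
        (fun i h0 hi h => ?_) (fun i h => o1 w.1 ?_) (fun i hi => ?_) huS ?_
      · have := congrArg Prod.snd h
        simp only [Prod.smul_mk, nsmul_eq_mul, mul_one, Prod.snd_zero] at this
        rw [ZMod.natCast_eq_zero_iff] at this
        exact absurd (Nat.le_of_dvd h0 this) (by lia)
      · have := congrArg Prod.fst h
        simp at this
        linear_combination -this
      · refine ⟨hwS _ ?_, hwS _ ?_⟩
        · simpa [col] using hw
        · rcases hw with hw | hw <;> simp [col, hw]
      · have huw : u.1 = w.1 ∨ u.1 = 1 - w.1 := by
          rcases hu with hu | hu <;> rcases hw with hw | hw <;> simp [hu, hw]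
        rcases huw with huw | huw
        · refine ⟨(u.2 - w.2).val, ZMod.val_lt _, Or.inl ?_⟩
          ext <;> simp [huw]
        · refine ⟨(-w.2 - u.2).val, ZMod.val_lt _, Or.inr ?_⟩
          ext <;> simp [huw]
    exact htrans _ _ _ (hsymm _ _ (key u hu huS)) (key v hv hvS)
  -- each ring of the first direction meets each ring of the second outside `S`
  have hmeet : ∀ x y, ∃ t ∉ S, row y t ∧ col x t := by
    intro x y
    by_contra! hno
    have d1 : x ≠ 1 - x := fun h => o1 x (by linear_combination h)
    have d2 : y ≠ 1 - y := fun h => o2 y (by linear_combination h)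
    have m : ∀ t, row y t → col x t → t = p ∨ t = q := fun t h1 h2 =>
      hS' t (by_contra fun h => hno t h h1 h2)
    have m1 := m (x, y) (Or.inl rfl) (Or.inl rfl)
    have m2 := m (1 - x, y) (Or.inl rfl) (Or.inr rfl)
    have m3 := m (x, 1 - y) (Or.inr rfl) (Or.inl rfl)
    exact not_three_distinct m1 m2 m3 (fun h => d1 (congrArg Prod.fst h))
      (fun h => d2 (congrArg Prod.snd h)) (fun h => d2 (congrArg Prod.snd h))
  obtain ⟨y₀, hy₀⟩ : ∃ y, ¬ (row y p ∧ row y q) :=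
    (exists_ne_and_ne_one_sub t2 p.2).imp fun y hy h => hy h.1
  obtain ⟨x₀, hx₀⟩ : ∃ x, ¬ (col x p ∧ col x q) :=
    (exists_ne_and_ne_one_sub t1 p.1).imp fun x hx h => hx h.1
  obtain ⟨h, hhS, hh1, hh2⟩ := hmeet x₀ y₀
  refine ⟨h, hhS, ?_⟩
  have c1 : ∀ u ∉ S, ¬ (row u.2 p ∧ row u.2 q) → r u h := by
    intro u hu hg
    obtain ⟨t, htS, ht1, ht2⟩ := hmeet x₀ u.2
    exact htrans _ _ _ (hrow _ hg u t (Or.inl rfl) ht1 hu htS) (hcol _ hx₀ t h ht2 hh2 htS hhS)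
  have c2 : ∀ u ∉ S, ¬ (col u.1 p ∧ col u.1 q) → r u h := by
    intro u hu hg
    obtain ⟨t, htS, ht1, ht2⟩ := hmeet u.1 y₀
    exact htrans _ _ _ (hcol _ hg u t (Or.inl rfl) ht2 hu htS) (hrow _ hy₀ t h ht1 hh1 htS hhS)
  -- If both rings through u contain p and q, a neighbour obtained by negating the coordinate with
  -- nonzero double lies on a good ring.
  have c3 : ∀ u ∉ S, 2 * u.1 ≠ 0 ∨ 2 * u.2 ≠ 0 → r u h := by
    intro u hu hne
    by_cases g1 : row u.2 p ∧ row u.2 q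
    swap
    · exact c1 u hu g1
    by_cases g2 : col u.1 p ∧ col u.1 q
    swap
    · exact c2 u hu g2
    rcases hne with hne | hne
    · have hv : ¬ (col (-u.1) p) ∧ ¬ (col (-u.1) q) :=
        ⟨ne_neg_and_ne_one_sub_neg o1 hne g2.1, ne_neg_and_ne_one_sub_neg o1 hne g2.2⟩
      have hvS : (0, 1) - u ∉ S := fun hv' => by
        rcases hS' _ hv' with h | h
        · exact hv.1 (Or.inl (by rw [← h]; simp))
        · exact hv.2 (Or.inl (by rw [← h]; simp))
      exact htrans _ _ _ (a2 u hu hvS) (c2 _ hvS fun h => hv.1 (by simpa using h.1))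
    · have hv : ¬ (row (-u.2) p) ∧ ¬ (row (-u.2) q) :=
        ⟨ne_neg_and_ne_one_sub_neg o2 hne g1.1, ne_neg_and_ne_one_sub_neg o2 hne g1.2⟩
      have hvS : (1, 0) - u ∉ S := fun hv' => by
        rcases hS' _ hv' with h | h
        · exact hv.1 (Or.inl (by rw [← h]; simp))
        · exact hv.2 (Or.inl (by rw [← h]; simp))
      exact htrans _ _ _ (a1 u hu hvS) (c1 _ hvS fun h => hv.1 (by simpa using h.1))
  intro u hu
  by_cases hne : 2 * u.1 ≠ 0 ∨ 2 * u.2 ≠ 0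
  · exact c3 u hu hne
  push Not at hne
  obtain ⟨z1, z2⟩ := hne
  -- When 2u = 0, one of the three neighbours survives, and twice it is nonzero because 2 ≠ 0 in
  -- both factors.
  by_cases w1 : (1, 0) - u ∈ S
  swap
  · exact htrans _ _ _ (a1 u hu w1) (c3 _ w1 (Or.inl (by simp [mul_sub, z1, t1])))
  by_cases w2 : (0, 1) - u ∈ S
  swap
  · exact htrans _ _ _ (a2 u hu w2) (c3 _ w2 (Or.inr (by simp [mul_sub, z2, t2])))
  have w3 : (1, 1) - u ∉ S := by
    intro w3
    have e1 := hS' _ w1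
    have e2 := hS' _ w2
    have e3 := hS' _ w3
    have n12 : ((1, 0) - u : ZMod (2 * a) × ZMod (2 * b)) ≠ (0, 1) - u := fun h => i1 (by
      simpa using congrArg Prod.fst h)
    have n13 : ((1, 0) - u : ZMod (2 * a) × ZMod (2 * b)) ≠ (1, 1) - u := fun h => i2 (by
      simpa using (congrArg Prod.snd h).symm)
    have n23 : ((0, 1) - u : ZMod (2 * a) × ZMod (2 * b)) ≠ (1, 1) - u := fun h => i1 (by
      simpa using (congrArg Prod.fst h).symm)
    exact not_three_distinct e1 e2 e3 n12 n13 n23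
  exact htrans _ _ _ (a3 u hu w3) (c3 _ w3 (Or.inl (by simp [mul_sub, z1, t1])))

theorem isThreeConnected (ha : 2 ≤ a) (hb : 2 ≤ b) :
    CombinatorialMap.IsThreeConnected (sumGraph a b) := by
  have : NeZero (2 * a) := ⟨by lia⟩
  have : NeZero (2 * b) := ⟨by lia⟩
  constructor
  · rw [ENat.card_eq_coe_natCard, Nat.card_prod, Nat.card_zmod, Nat.card_zmod]
    norm_cast
    nlinarith
  · intro S hS
    obtain ⟨p, q, hpq⟩ : ∃ p q, S ⊆ {p, q} := by
      have h2 : S.encard ≤ 2 := Order.le_of_lt_add_one (by norm_num; exact hS)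
      have hfin : S.Finite := Set.finite_of_encard_le_coe (k := 2) h2
      have h2' : S.encard = 0 ∨ S.encard = 1 ∨ S.encard = 2 := by
        rw [← hfin.cast_ncard_eq] at h2 ⊢
        norm_cast at h2 ⊢
        lia
      rcases h2' with h | h | h
      · rw [Set.encard_eq_zero] at h
        exact ⟨0, 0, by simp [h]⟩
      · obtain ⟨p, rfl⟩ := Set.encard_eq_one.1 h
        exact ⟨p, p, by simp⟩
      · obtain ⟨p, q, -, rfl⟩ := Set.encard_eq_two.1 h
        exact ⟨p, q, subset_rfl⟩
    obtain ⟨h, hh, hub⟩ := exists_hub ha hb hpq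
      (r := fun u v => ∃ (hu : u ∉ S) (hv : v ∉ S),
        ((sumGraph a b).induce Sᶜ).Reachable ⟨u, hu⟩ ⟨v, hv⟩)
      (fun u hu => ⟨hu, hu, SimpleGraph.Reachable.refl _⟩)
      (fun u v ⟨hu, hv, h⟩ => ⟨hv, hu, h.symm⟩)
      (fun u v w ⟨hu, hv, h⟩ ⟨hv', hw, h'⟩ => ⟨hu, hw, h.trans h'⟩)
      (fun u v hu hv h => ⟨hu, hv, SimpleGraph.Adj.reachable h⟩)
    have : Nonempty (Sᶜ : Set (ZMod (2 * a) × ZMod (2 * b))) := ⟨⟨h, hh⟩⟩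
    refine ⟨fun u v => ?_⟩
    obtain ⟨_, _, hu⟩ := hub u.1 u.2
    obtain ⟨_, _, hv⟩ := hub v.1 v.2
    exact hu.trans hv.symm

end sumGraph

/-! ### Counting faces -/

/-- Counting the cycles of a permutation all of whose cycles have length three or six. -/
theorem six_mul_card_quotient {D : Type*} [Finite D] (p : Perm D)
    (hp : ∀ d, Function.minimalPeriod p d = 3 ∨ Function.minimalPeriod p d = 6) :
    6 * Nat.card (Quotient (Perm.SameCycle.setoid p)) =
      Nat.card D + Nat.card {d // p (p (p d)) = d} := by
  classical
  have := Fintype.ofFinite D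
  have := Fintype.ofFinite (Quotient (Perm.SameCycle.setoid p))
  let mk : D → Quotient (Perm.SameCycle.setoid p) := Quotient.mk _
  have hfix : ∀ d, p (p (p d)) = d ↔ Function.minimalPeriod p d = 3 := fun d => by
    constructor
    · intro hd
      have := Function.IsPeriodicPt.minimalPeriod_dvd (f := p) (n := 3) (x := d) hd
      rcases hp d with h | h
      · exact h
      · rw [h] at this; norm_num at this
    · intro hd
      have := Function.iterate_minimalPeriod (f := p) (x := d)
      rw [hd] at this
      exact this
  -- A cycle of length 3 contributes 3 + 3, since all its points are counted twice; one of length 6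
  -- contributes 6 + 0.
  have h1 : ∀ q, (Finset.univ.filter fun d => mk d = q).card +
      ((Finset.univ.filter fun d => p (p (p d)) = d).filter fun d => mk d = q).card = 6 := by
    intro q
    obtain ⟨d, rfl⟩ : ∃ d, mk d = q := Quotient.exists_rep q
    have hc := card_sameCycle_fiber p d
    have hc' : (Finset.univ.filter fun e => mk e = mk d).card = Function.minimalPeriod p d := by
      rw [← hc, Nat.card_eq_fintype_card, Fintype.card_subtype]
    have hper : ∀ e, mk e = mk d → Function.minimalPeriod p e = Function.minimalPeriod p d := by
      intro e he
      rw [← hc, ← card_sameCycle_fiber p e]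
      exact congrArg (fun q => Nat.card {x // mk x = q}) he
    rw [Finset.filter_filter]
    rcases hp d with h | h
    · have : (Finset.univ.filter fun e => p (p (p e)) = e ∧ mk e = mk d) =
          Finset.univ.filter fun e => mk e = mk d := by
        refine Finset.filter_congr fun e _ => ⟨And.right, fun he => ⟨?_, he⟩⟩
        rw [hfix, hper e he, h]
      rw [this, hc', h]
    · have : (Finset.univ.filter fun e => p (p (p e)) = e ∧ mk e = mk d) = ∅ := by
        refine Finset.filter_eq_empty_iff.2 fun e _ he => ?_
        have := (hfix e).1 he.1
        rw [hper e he.2, h] at this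
        norm_num at this
      rw [this, hc', h, Finset.card_empty]
  rw [Nat.card_eq_fintype_card, Nat.card_eq_fintype_card, Nat.card_eq_fintype_card,
    Fintype.card_subtype, ← Finset.card_univ, ← Finset.card_univ,
    Finset.card_eq_sum_card_fiberwise (f := mk) (s := Finset.univ) (t := Finset.univ) (by simp),
    Finset.card_eq_sum_card_fiberwise (f := mk)
      (s := Finset.univ.filter fun d => p (p (p d)) = d) (t := Finset.univ) (by simp),
    ← Finset.sum_add_distrib, Finset.sum_congr rfl (fun q _ => h1 q)]
  simp [mul_comm]

theorem minimalPeriod_eq_three {D : Type*} {f : D → D} {d : D} (h3 : f (f (f d)) = d)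
    (h1 : f d ≠ d) : Function.minimalPeriod f d = 3 := by
  have h := Function.IsPeriodicPt.minimalPeriod_dvd (f := f) (n := 3) (x := d) h3
  rcases (Nat.dvd_prime Nat.prime_three).1 h with h | h
  · exact absurd (Function.minimalPeriod_eq_one_iff_isFixedPt.1 h) h1
  · exact h

theorem minimalPeriod_eq_three_or_six {D : Type*} {f : D → D} {d : D}
    (h6 : f (f (f (f (f (f d))))) = d) (h2 : f (f d) ≠ d) :
    Function.minimalPeriod f d = 3 ∨ Function.minimalPeriod f d = 6 := by
  have h := Function.IsPeriodicPt.minimalPeriod_dvd (f := f) (n := 6) (x := d) h6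
  have hn : ¬ Function.minimalPeriod f d ∣ 2 := fun h =>
    h2 ((Function.isPeriodicPt_iff_minimalPeriod_dvd (n := 2)).2 h)
  have hle := Nat.le_of_dvd (by norm_num) h
  generalize Function.minimalPeriod f d = k at *
  interval_cases k <;> simp_all

/-! ### A map of type 3_n with a railroad for composite n/4 -/

namespace CombinatorialMap

theorem IsThreeConnected.connected {V : Type*} {G : SimpleGraph V} (h : IsThreeConnected G) :
    G.Connected := by
  have h0 := h.2 ∅ (by simp)
  have hne : Nonempty V := ⟨h0.nonempty.some.1⟩
  refine ⟨fun u v => ?_⟩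
  exact (h0.preconnected ⟨u, by simp⟩ ⟨v, by simp⟩).map (SimpleGraph.Embedding.induce _).toHom

theorem IsThreeConnected.of_iso {V W : Type*} {G : SimpleGraph V} {H : SimpleGraph W}
    (h : IsThreeConnected G) (φ : G ≃g H) : IsThreeConnected H := by
  refine ⟨?_, fun S hS => ?_⟩
  · rw [← ENat.card_congr φ.toEquiv]
    exact h.1
  · have hc := h.2 (φ ⁻¹' S) (by
      rw [Set.encard_preimage_of_bijective φ.bijective]
      exact hS)
    have ψ : G.induce (φ ⁻¹' S)ᶜ ≃g H.induce Sᶜ :=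
      { toEquiv := φ.toEquiv.subtypeEquiv fun _ => Iff.rfl
        map_rel_iff' := φ.map_rel_iff }
    exact ψ.connected_iff.1 hc

variable (a b : ℕ)

/-- The possible sums of two adjacent vertices. -/
def label (k : Fin 3) : ZMod (2 * a) × ZMod (2 * b) := ![(1, 0), (0, 1), (1, 1)] k

theorem label_sub_ne (z : ZMod (2 * a) × ZMod (2 * b)) (k : Fin 3) : label a b k - z ≠ z := by
  intro h
  have h1 := congrArg Prod.fst h
  have h2 := congrArg Prod.snd h
  fin_cases k <;> simp [label] at h1 h2
  · exact ZMod.two_mul_ne_one a z.1 (by linear_combination -h1)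
  · exact ZMod.two_mul_ne_one b z.2 (by linear_combination -h2)
  · exact ZMod.two_mul_ne_one a z.1 (by linear_combination -h1)

/-- The quotient of the hexagonal tiling of the plane with underlying graph `sumGraph a b`. -/
def sumMap : CombinatorialMap ((ZMod (2 * a) × ZMod (2 * b)) × Fin 3) where
  rot := (Equiv.refl _).prodCongr (Equiv.addRight 1)
  opp := Function.Involutive.toPerm (fun d => (label a b d.2 - d.1, d.2)) fun _ =>
    Prod.ext (sub_sub_cancel _ _) rfl
  opp_opp _ := Prod.ext (sub_sub_cancel _ _) rfl
  opp_ne d h := label_sub_ne a b d.1 d.2 (congrArg Prod.fst h)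

namespace sumMap

variable {a b}

theorem rot_apply (z : ZMod (2 * a) × ZMod (2 * b)) (k : Fin 3) :
    (sumMap a b).rot (z, k) = (z, k + 1) := rfl

theorem opp_apply (z : ZMod (2 * a) × ZMod (2 * b)) (k : Fin 3) :
    (sumMap a b).opp (z, k) = (label a b k - z, k) := rfl

theorem next_apply (z : ZMod (2 * a) × ZMod (2 * b)) (k : Fin 3) :
    (sumMap a b).next (z, k) = (label a b k - z, k + 1) := rfl

/-- Half a circuit of a face is the half turn about its centre, so triangles correspond to the
solutions of 2z = 2c, with c read off from the label. -/
theorem next_next_next (z : ZMod (2 * a) × ZMod (2 * b)) (k : Fin 3) :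
    (sumMap a b).next ((sumMap a b).next ((sumMap a b).next (z, k))) =
      (2 • ((1, 1) - label a b (k + 1)) - z, k) := by
  simp only [next_apply]
  have h3 : k + 1 + 1 + 1 = k := by fin_cases k <;> rfl
  rw [h3]
  refine Prod.ext (Prod.ext ?_ ?_) rfl <;> fin_cases k <;> simp [label] <;> ring

theorem rot_rot_rot (d) :
    (sumMap a b).rot ((sumMap a b).rot ((sumMap a b).rot d)) = d := by
  obtain ⟨z, k⟩ := d
  have h3 : k + 1 + 1 + 1 = k := by fin_cases k <;> rfl
  simp only [rot_apply, h3]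

theorem minimalPeriod_rot (d) : Function.minimalPeriod (sumMap a b).rot d = 3 := by
  refine minimalPeriod_eq_three (rot_rot_rot d) ?_
  obtain ⟨z, k⟩ := d
  intro h
  have : k + 1 = k := congrArg Prod.snd h
  fin_cases k <;> simp at this

theorem minimalPeriod_next (d) : Function.minimalPeriod (sumMap a b).next d = 3 ∨
    Function.minimalPeriod (sumMap a b).next d = 6 := by
  obtain ⟨z, k⟩ := d
  refine minimalPeriod_eq_three_or_six ?_ fun h => ?_
  · rw [next_next_next, next_next_next, sub_sub_cancel]
  · have : k + 1 + 1 = k := congrArg Prod.snd h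
    fin_cases k <;> simp at this

theorem minimalPeriod_opp (d) : Function.minimalPeriod (sumMap a b).opp d = 2 := by
  have h := Function.IsPeriodicPt.minimalPeriod_dvd (f := (sumMap a b).opp) (n := 2) (x := d)
    ((sumMap a b).opp_opp d)
  rcases (Nat.dvd_prime Nat.prime_two).1 h with h | h
  · exact absurd (Function.minimalPeriod_eq_one_iff_isFixedPt.1 h) ((sumMap a b).opp_ne d)
  · exact h

section Finite

theorem card_dart : Nat.card ((ZMod (2 * a) × ZMod (2 * b)) × Fin 3) = 12 * (a * b) := by
  simp only [Nat.card_prod, Nat.card_zmod, Nat.card_fin]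
  ring

variable [NeZero a] [NeZero b]

theorem card_vertex : Nat.card (sumMap a b).Vertex = 4 * (a * b) := by
  have := card_quotient_mul (Perm.SameCycle.setoid (sumMap a b).rot) 3 fun q => by
    obtain ⟨d, rfl⟩ := Quotient.exists_rep q
    rw [card_sameCycle_fiber, minimalPeriod_rot]
  rw [card_dart] at this
  change Nat.card (sumMap a b).Vertex * 3 = _ at this
  lia

theorem card_edge : Nat.card (sumMap a b).Edge = 6 * (a * b) := by
  have := card_quotient_mul (Perm.SameCycle.setoid (sumMap a b).opp) 2 fun q => by
    obtain ⟨d, rfl⟩ := Quotient.exists_rep q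
    rw [card_sameCycle_fiber, minimalPeriod_opp]
  rw [card_dart] at this
  change Nat.card (sumMap a b).Edge * 2 = _ at this
  lia

/-- For each of the three labels, doubling has two solutions in each coordinate: 3 · 2 · 2 darts,
that is, four triangles, as the Euler characteristic requires. -/
theorem card_triangle_dart : Nat.card {d // (sumMap a b).next ((sumMap a b).next
    ((sumMap a b).next d)) = d} = 12 := by
  have e : {d // (sumMap a b).next ((sumMap a b).next ((sumMap a b).next d)) = d} ≃
      Σ k : Fin 3, {x : ZMod (2 * a) // 2 * x = 2 * (1 - (label a b (k + 1)).1)} ×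
        {y : ZMod (2 * b) // 2 * y = 2 * (1 - (label a b (k + 1)).2)} :=
    { toFun := fun d => ⟨d.1.2, ⟨d.1.1.1, by
          have := congrArg (fun d => d.1.1) d.2
          rw [next_next_next] at this
          simp at this
          linear_combination -this⟩, ⟨d.1.1.2, by
          have := congrArg (fun d => d.1.2) d.2
          rw [next_next_next] at this
          simp at this
          linear_combination -this⟩⟩
      invFun := fun x => ⟨((x.2.1.1, x.2.2.1), x.1), by
        rw [next_next_next]
        have h1 := x.2.1.2
        have h2 := x.2.2.2
        ext
        · simp; linear_combination -h1
        · simp; linear_combination -h2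
        · rfl⟩
      left_inv := fun d => rfl
      right_inv := fun x => rfl }
  rw [Nat.card_congr e, Nat.card_sigma]
  simp only [Nat.card_prod, ZMod.card_two_mul_eq]
  simp

theorem card_face : Nat.card (sumMap a b).Face = 2 * (a * b) + 2 := by
  have := six_mul_card_quotient (sumMap a b).next minimalPeriod_next
  rw [card_dart, card_triangle_dart] at this
  change 6 * Nat.card (sumMap a b).Face = _ at this
  lia

theorem tail_eq_iff {d e} : (sumMap a b).tail d = (sumMap a b).tail e ↔ d.1 = e.1 := by
  rw [CombinatorialMap.tail_eq_iff (rot_rot_rot e)]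
  obtain ⟨z, k⟩ := d
  obtain ⟨w, l⟩ := e
  simp only [rot_apply, Prod.mk.injEq]
  have : k = l ∨ k = l + 1 ∨ k = l + 1 + 1 := by
    fin_cases k <;> fin_cases l <;> simp
  tauto

theorem bijective_tail :
    Function.Bijective fun z : ZMod (2 * a) × ZMod (2 * b) => (sumMap a b).tail (z, 0) := by
  constructor
  · intro z w h
    exact tail_eq_iff.1 h
  · intro v
    obtain ⟨d, rfl⟩ := exists_tail_eq v
    exact ⟨d.1, tail_eq_iff.2 rfl⟩

variable (a b) in
/-- The underlying graph of `sumMap a b` is `sumGraph a b`. -/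
noncomputable def iso : sumGraph a b ≃g (sumMap a b).skeleton where
  toEquiv := Equiv.ofBijective _ bijective_tail
  map_rel_iff' {z w} := by
    change ((sumMap a b).tail (z, 0) ≠ (sumMap a b).tail (w, 0) ∧
      ∃ d, (sumMap a b).tail d = (sumMap a b).tail (z, 0) ∧
        (sumMap a b).tail ((sumMap a b).opp d) = (sumMap a b).tail (w, 0)) ↔
      z ≠ w ∧ (w = (1, 0) - z ∨ w = (0, 1) - z ∨ w = (1, 1) - z)
    simp only [ne_eq, tail_eq_iff]
    refine and_congr_right fun _ => ?_
    constructor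
    · rintro ⟨⟨x, k⟩, rfl, h⟩
      rw [opp_apply] at h
      fin_cases k
      · exact Or.inl h.symm
      · exact Or.inr (Or.inl h.symm)
      · exact Or.inr (Or.inr h.symm)
    · rintro (rfl | rfl | rfl)
      · exact ⟨(z, 0), rfl, rfl⟩
      · exact ⟨(z, 1), rfl, rfl⟩
      · exact ⟨(z, 2), rfl, rfl⟩

theorem isSimple : (sumMap a b).IsSimple := by
  refine ⟨fun d h => ?_, fun d e h h' => ?_⟩
  · rw [tail_eq_iff] at h
    exact label_sub_ne a b d.1 d.2 h
  · rw [tail_eq_iff] at h h'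
    obtain ⟨z, k⟩ := d
    obtain ⟨w, l⟩ := e
    obtain rfl : z = w := h
    have h' : label a b k - z = label a b l - z := h'
    rw [sub_left_inj] at h'
    have i1 : (1 : ZMod (2 * a)) ≠ 0 := fun h => ZMod.two_mul_ne_one a 0 (by rw [h, mul_zero])
    have i2 : (1 : ZMod (2 * b)) ≠ 0 := fun h => ZMod.two_mul_ne_one b 0 (by rw [h, mul_zero])
    have : k = l := by
      fin_cases k <;> fin_cases l <;> simp [label, i1, i2, i1.symm, i2.symm] at h' ⊢
    rw [this]

theorem isTypeThree (ha : 2 ≤ a) (hb : 2 ≤ b) : (sumMap a b).IsTypeThree (4 * (a * b)) where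
  polyhedral := by
    have h3 := (sumGraph.isThreeConnected ha hb).of_iso (iso a b)
    refine ⟨isSimple, ⟨h3.connected, ?_⟩, h3⟩
    rw [card_vertex, card_edge, card_face]
    lia
  card_vertex := card_vertex
  degree_eq v := by
    obtain ⟨d, rfl⟩ := exists_tail_eq v
    rw [degree_tail, minimalPeriod_rot]
  faceSize_eq f := by
    obtain ⟨d, rfl⟩ : ∃ d, (sumMap a b).leftFace d = f := Quotient.exists_rep f
    rw [faceSize_leftFace]
    exact minimalPeriod_next d
  exists_triangle := by
    refine ⟨(sumMap a b).leftFace ((1, 1) - label a b 1, 0), ?_⟩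
    rw [faceSize_leftFace]
    refine minimalPeriod_eq_three ?_ fun h => ?_
    · rw [next_next_next]
      rw [zero_add, two_nsmul, add_sub_cancel_right]
    · have : (0 : Fin 3) + 1 = 0 := congrArg Prod.snd h
      simp at this

/-- The hexagons centred on a line of the first direction that misses the triangles. -/
def railroad (ha : 0 < a) (hb : 2 ≤ b) : (sumMap a b).Railroad where
  length := 2 * a
  length_pos := by lia
  -- Crossing a hexagon from label 0 lowers the first coordinate by 1. A triangle side with label 0
  -- has second coordinate y with 2y = 0, which y = 1 violates as b ≥ 2.
  entry i := ((-i, 1), 0)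
  entry_injective i j h := by simpa using h
  hexagonal i := by
    rw [faceSize_leftFace]
    refine (minimalPeriod_next _).resolve_left fun h => ?_
    have h3 := Function.iterate_minimalPeriod (f := (sumMap a b).next) (x := ((-i, 1), 0))
    rw [h] at h3
    have h3' : (sumMap a b).next ((sumMap a b).next ((sumMap a b).next ((-i, 1), 0))) =
      ((-i, 1), 0) := h3
    rw [next_next_next] at h3'
    have := congrArg (fun d => d.1.2) h3'
    simp [label] at this
    exact ZMod.two_ne_zero_of_two_le hb (by linear_combination -this)
  step i := by
    rw [next_next_next, opp_apply]
    ext <;> simp [label]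
    ring

end Finite

end sumMap

end CombinatorialMap

theorem theorem5p5 (n : ℕ) (hdvd : 4 ∣ n) (hn : 4 < n) :
    (∀ (D : Type) [Finite D] (M : CombinatorialMap D), M.IsTypeThree n → M.IsTight) ↔
      (n / 4).Prime := by
  refine ⟨fun h => ?_, fun hp D _ M hM => hM.isTight hn hp⟩
  obtain ⟨m, rfl⟩ := hdvd
  rw [Nat.mul_div_cancel_left m (by norm_num)]
  by_contra hm
  obtain ⟨a, b, ha, hb, rfl⟩ := (Nat.not_prime_iff_exists_mul_eq (by lia)).1 hm
  have ha2 : 2 ≤ a := by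
    by_contra h
    interval_cases a <;> lia
  have hb2 : 2 ≤ b := by
    by_contra h
    interval_cases b <;> lia
  have : NeZero a := ⟨by lia⟩
  have : NeZero b := ⟨by lia⟩
  exact (h _ _ (CombinatorialMap.sumMap.isTypeThree ha2 hb2)).false
    (CombinatorialMap.sumMap.railroad (by lia) hb2)
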